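/- For a finite set $A$ let $S_A$ be its group of permutations, $\mathbb{C}(S_A)$ the group algebra, and $\#\sigma$ the number of cycles of $\sigma\in S_A$ (fixed points included). For $N\in\mathbb{N}$ put $\Phi^N_A=\sum_{\sigma\in S_A}N^{\#\sigma}\sigma\in\mathbb{C}(S_A)$, and, when $\Phi^N_A$ is invertible, let $W^N_\sigma$ be the coefficient of $\sigma$ in $(\Phi^N_A)^{-1}$. Let $w_1,\dots,w_p$ be non-empty words (reduced or not) in the letters $u^{\pm1},v^{\pm1}$ of the free group $F_2$, and let $W_i=w_i(U,V)$ be the corresponding functions of $(U,V)\in\mathcal U(N)^2$. Let $X$ be the set of all occurrences of letters in the $2p$ words $w_1,w_1^{-1},\dots,w_p,w_p^{-1}$, where $w^{-1}=a_k^{-1}\cdots a_1^{-1}$ for $w=a_1\cdots a_k$, and let $\widetilde U,\widetilde U^*,\widetilde V,\widetilde V^*\subset X$ be the sets of occurrences of $u,u^{-1},v,v^{-1}$. Let $\Psi:X\to X$ be the involution that sends an occurrence $a_j$ in $w_i$ to the corresponding occurrence $a_j^{-1}$ in $w_i^{-1}$ and vice versa; it exchanges $\widetilde U$ with $\widetilde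 U^*$ and $\widetilde V$ with $\widetilde V^*$. Let $I:X\to X$ send $a$ to the cyclic successor of $\Psi(a)$ in the word that contains $\Psi(a)$. For $\sigma_u\in S_{\widetilde U}$, $\theta_u\in S_{\widetilde U^*}$, $\sigma_v\in S_{\widetilde V}$, $\theta_v\in S_{\widetilde V^*}$ let $(\sigma_u,\theta_u,\sigma_v,\theta_v)$ be their concatenation to a permutation of $X$. Let $$R=\sum_{\sigma_u,\theta_u,\sigma_v,\theta_v}N^{\#(I\circ(\sigma_u,\theta_u,\sigma_v,\theta_v))}\,\sigma_u\otimes\theta_u\otimes\sigma_v\otimes\theta_v\in\mathbb{C}(S_{\widetilde U})\otimes\mathbb{C}(S_{\widetilde U^*})\otimes\mathbb{C}(S_{\widetilde V})\otimes\mathbb{C}(S_{\widetilde V^*}).$$ Assume $N\ge|\widetilde U|$ and $N\ge|\widetilde V|$. Then $\Phi^N_{\widetilde U}$ and $\Phi^N_{\widetilde V}$ are invertible. Let $\Phi$ be the linear functional on the above tensor product with $\Phi(\sigma_1\otimes\theta_1\otimes\sigma_2\otimes\theta_2)=W^N_{\sigma_1\Psi^{-1}\theta_1\Psi}\,W^N_{\sigma_2\Psi^{-1}\theta_2\Psi}$.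 Then, with respect to the normalized Haar measure, $$\iint_{\mathcal U(N)^2}|\mathrm{Tr}(W_1)|^2\cdots|\mathrm{Tr}(W_p)|^2\,dU\,dV=\Phi(R).$$ Moreover $R$ depends only on the cardinalities $|I(A)\cap B|$, $A,B\in\{\widetilde U,\widetilde U^*,\widetilde V,\widetilde V^*\}$: if a second finite family of words has the same cardinalities, then there are bijections between the corresponding sets of occurrences $\widetilde U,\widetilde U^*,\widetilde V,\widetilde V^*$ of the two families such that the induced identification of the tensor products maps the one element $R$ to the other. -/

import Mathlib

open scoped TensorProduct

namespace WordTrace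

/-! ### Cycles and Weingarten coefficients -/

/-- The number of cycles of a permutation, fixed points included: the number of its orbits. -/
noncomputable def numCycles {α : Type*} (σ : Equiv.Perm α) : ℕ :=
  Nat.card (Quotient (Equiv.Perm.SameCycle.setoid σ))

/-- `Φ^N = ∑_σ N^{#σ} σ` in the group algebra of the permutations of `α`. -/
noncomputable def cycleElement (N : ℕ) (α : Type*) [Fintype α] [DecidableEq α] :
    MonoidAlgebra ℂ (Equiv.Perm α) :=
  ∑ σ : Equiv.Perm α, MonoidAlgebra.single σ ((N : ℂ) ^ numCycles σ)

/-- `W^N_σ`: the coefficient of `σ` in the inverse of `Φ^N`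
(meaningful when `Φ^N` is invertible). -/
noncomputable def weingarten (N : ℕ) {α : Type*} [Fintype α] [DecidableEq α]
    (σ : Equiv.Perm α) : ℂ :=
  (Ring.inverse (cycleElement N α)).coeff σ

/-! ### Words in two letters and their evaluation at unitary matrices -/

/-- A letter: `(0, true) = u`, `(0, false) = u⁻¹`, `(1, true) = v`, `(1, false) = v⁻¹`. -/
abbrev Letter : Type := Fin 2 × Bool

abbrev letterU : Letter := (0, true)
abbrev letterUStar : Letter := (0, false)
abbrev letterV : Letter := (1, true)
abbrev letterVStar : Letter := (1, false)

/-- A word, reduced or not; it represents the element `FreeGroup.mk L` of the free group. -/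
abbrev Word : Type := List Letter

/-- The unitary group `U(N)`. -/
abbrev UGroup (N : ℕ) : Type := ↥(Matrix.unitaryGroup (Fin N) ℂ)

/-- The value `W(U, V)` of a word: the image under the homomorphism `u ↦ U, v ↦ V`. -/
noncomputable def evalWord {N : ℕ} (L : Word) (U V : UGroup N) : UGroup N :=
  FreeGroup.lift ![U, V] (FreeGroup.mk L)

/-- `Tr (W(U, V))`, the non-normalized trace. -/
noncomputable def traceWord {N : ℕ} (L : Word) (U V : UGroup N) : ℂ :=
  Matrix.trace (evalWord L U V : Matrix (Fin N) (Fin N) ℂ)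

/-! ### Haar measure on `U(N)` -/

instance (N : ℕ) : CompactSpace (UGroup N) := by
  refine isCompact_iff_compactSpace.mp ?_
  have hK : IsCompact (Set.univ.pi fun _ : Fin N => Set.univ.pi fun _ : Fin N =>
      Metric.closedBall (0 : ℂ) 1) :=
    isCompact_univ_pi fun _ => isCompact_univ_pi fun _ => isCompact_closedBall _ _
  refine IsCompact.of_isClosed_subset hK isClosed_unitary ?_
  intro A hA i _ j _
  simpa using entry_norm_bound_of_unitary (𝕜 := ℂ) (n := Fin N) hA i j

noncomputable instance (N : ℕ) : MeasurableSpace (UGroup N) := borel _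

instance (N : ℕ) : BorelSpace (UGroup N) := ⟨rfl⟩

/-- The Haar measure on `U(N)` of total mass one. -/
noncomputable def haarU (N : ℕ) : MeasureTheory.Measure (UGroup N) :=
  MeasureTheory.Measure.haarMeasure ⊤

/-! ### The set `X` of letter occurrences -/

section Occurrences

variable {p : ℕ} (w : Fin p → Word)

/-- The words of `∏ᵢ |Tr Wᵢ|² = ∏ᵢ Tr Wᵢ · Tr Wᵢ⁻¹`: index `(i, true)` stands for `wᵢ`,
and `(i, false)` for its inverse word. -/
def wordAt (q : Fin p × Bool) : Word :=
  if q.2 then w q.1 else FreeGroup.invRev (w q.1)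

theorem wordAt_not (i : Fin p) (b : Bool) :
    wordAt w (i, !b) = FreeGroup.invRev (wordAt w (i, b)) := by
  cases b <;> simp [wordAt, FreeGroup.invRev_invRev]

theorem length_wordAt_not (i : Fin p) (b : Bool) :
    (wordAt w (i, b)).length = (wordAt w (i, !b)).length := by
  rw [wordAt_not, FreeGroup.invRev_length]

/-- The set `X`: an occurrence is a word together with a position (from `0`) in that word. -/
abbrev Occ : Type := Σ q : Fin p × Bool, Fin (wordAt w q).length

/-- The letter standing at an occurrence. -/
def letterAt (x : Occ w) : Letter := (wordAt w x.1).get x.2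

/-- The occurrences of a given letter: `Ũ`, `Ũ*`, `Ṽ` or `Ṽ*`. -/
abbrev OccOf (c : Letter) : Type := {x : Occ w // letterAt w x = c}

/-- The cyclic successor of an occurrence within its own word. -/
def succOcc : Equiv.Perm (Occ w) := Equiv.sigmaCongrRight fun _ => finRotate _

/-- The underlying map of `Ψ`: position `k` of a word corresponds to the `k`-th position from
the end of the inverse word. -/
def psiFun (x : Occ w) : Occ w :=
  ⟨(x.1.1, !x.1.2), Fin.cast (length_wordAt_not w x.1.1 x.1.2) x.2.rev⟩

theorem occ_ext {x y : Occ w} (h : x.1 = y.1) (h' : x.2.val = y.2.val) : x = y := by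
  obtain ⟨q, k⟩ := x
  obtain ⟨q', k'⟩ := y
  obtain rfl : q = q' := h
  obtain rfl : k = k' := Fin.ext h'
  rfl

theorem psiFun_involutive : Function.Involutive (psiFun w) := by
  rintro ⟨⟨i, b⟩, k⟩
  refine occ_ext w ?_ ?_
  · simp [psiFun]
  · have h := length_wordAt_not w i b
    have hk := k.isLt
    simp only [psiFun, Fin.val_cast, Fin.val_rev]
    omega

/-- `Ψ`: each symbol goes to the corresponding (inverse) symbol of the inverse word. -/
def psi : Equiv.Perm (Occ w) := (psiFun_involutive w).toPerm

/-- `I`: each symbol `a` goes to the successor of `Ψ(a)` in the word which contains `Ψ(a)`. -/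
def succPsi : Equiv.Perm (Occ w) := succOcc w * psi w

theorem letterAt_psi (x : Occ w) :
    letterAt w (psi w x) = ((letterAt w x).1, !(letterAt w x).2) := by
  obtain ⟨⟨i, b⟩, k⟩ := x
  have hk := k.isLt
  simp only [letterAt, psi, psiFun, Function.Involutive.coe_toPerm, List.get_eq_getElem,
    Fin.val_cast, Fin.val_rev, wordAt_not, FreeGroup.invRev, List.getElem_reverse,
    List.getElem_map, List.length_map]
  have e : (wordAt w (i, b)).length - 1 - ((wordAt w (i, b)).length - (k.1 + 1)) = k.1 := by
    omega
  simp only [e]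

/-- `Ψ` as a bijection from `Ũ` to `Ũ*` (for `g = 0`), and from `Ṽ` to `Ṽ*` (for `g = 1`). -/
def psiOn (g : Fin 2) : OccOf w (g, true) ≃ OccOf w (g, false) :=
  (psi w).subtypeEquiv fun x => by
    rw [letterAt_psi]
    obtain ⟨c, b⟩ := letterAt w x
    cases b <;> simp

/-- The concatenation `(σ_u, θ_u, σ_v, θ_v)` of permutations of the four classes of occurrences
to a permutation of `X` (the four factors have disjoint supports). -/
def concat (σu : Equiv.Perm (OccOf w letterU)) (θu : Equiv.Perm (OccOf w letterUStar))
    (σv : Equiv.Perm (OccOf w letterV)) (θv : Equiv.Perm (OccOf w letterVStar)) :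
    Equiv.Perm (Occ w) :=
  Equiv.Perm.ofSubtype σu * Equiv.Perm.ofSubtype θu *
    Equiv.Perm.ofSubtype σv * Equiv.Perm.ofSubtype θv

/-! ### The element `R` and the functional `Φ` -/

/-- The group algebra `ℂ(S_A)` of the permutations of the occurrences of a letter. -/
abbrev OccAlg (c : Letter) : Type := MonoidAlgebra ℂ (Equiv.Perm (OccOf w c))

/-- `ℂ(S_Ũ) ⊗ ℂ(S_Ũ*) ⊗ ℂ(S_Ṽ) ⊗ ℂ(S_Ṽ*)`. -/
abbrev TensorAlg : Type :=
  OccAlg w letterU ⊗[ℂ] OccAlg w letterUStar ⊗[ℂ] OccAlg w letterV ⊗[ℂ] OccAlg w letterVStar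

/-- The pure tensor `σ_u ⊗ θ_u ⊗ σ_v ⊗ θ_v`. -/
noncomputable def pureTensor
    (σu : Equiv.Perm (OccOf w letterU)) (θu : Equiv.Perm (OccOf w letterUStar))
    (σv : Equiv.Perm (OccOf w letterV)) (θv : Equiv.Perm (OccOf w letterVStar)) :
    TensorAlg w :=
  MonoidAlgebra.of ℂ _ σu ⊗ₜ[ℂ] MonoidAlgebra.of ℂ _ θu ⊗ₜ[ℂ]
    MonoidAlgebra.of ℂ _ σv ⊗ₜ[ℂ] MonoidAlgebra.of ℂ _ θv

/-- The element `R`. -/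
noncomputable def elementR (N : ℕ) : TensorAlg w :=
  ∑ σu : Equiv.Perm (OccOf w letterU), ∑ θu : Equiv.Perm (OccOf w letterUStar),
    ∑ σv : Equiv.Perm (OccOf w letterV), ∑ θv : Equiv.Perm (OccOf w letterVStar),
      ((N : ℂ) ^ numCycles (succPsi w * concat w σu θu σv θv)) • pureTensor w σu θu σv θv

/-- The permutation `σ Ψ⁻¹ θ Ψ` of the occurrences of a generator (`Ũ` or `Ṽ`). -/
def twist (g : Fin 2) (σ : Equiv.Perm (OccOf w (g, true)))
    (θ : Equiv.Perm (OccOf w (g, false))) : Equiv.Perm (OccOf w (g, true)) :=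
  σ * ((psiOn w g).trans (θ.trans (psiOn w g).symm))

/-- The basis of pure tensors of permutations. -/
noncomputable def tensorBasis :=
  (((MonoidAlgebra.basis (Equiv.Perm (OccOf w letterU)) ℂ).tensorProduct
    (MonoidAlgebra.basis (Equiv.Perm (OccOf w letterUStar)) ℂ)).tensorProduct
      (MonoidAlgebra.basis (Equiv.Perm (OccOf w letterV)) ℂ)).tensorProduct
        (MonoidAlgebra.basis (Equiv.Perm (OccOf w letterVStar)) ℂ)

/-- The linear functional `Φ`, defined by its values on pure tensors of permutations. -/
noncomputable def functionalPhi (N : ℕ) : TensorAlg w →ₗ[ℂ] ℂ :=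
  (tensorBasis w).constr ℂ fun t =>
    weingarten N (twist w 0 t.1.1.1 t.1.1.2) * weingarten N (twist w 1 t.1.2 t.2)

theorem functionalPhi_pureTensor (N : ℕ)
    (σu : Equiv.Perm (OccOf w letterU)) (θu : Equiv.Perm (OccOf w letterUStar))
    (σv : Equiv.Perm (OccOf w letterV)) (θv : Equiv.Perm (OccOf w letterVStar)) :
    functionalPhi w N (pureTensor w σu θu σv θv) =
      weingarten N (twist w 0 σu θu) * weingarten N (twist w 1 σv θv) := by
  have h : pureTensor w σu θu σv θv = tensorBasis w (((σu, θu), σv), θv) := by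
    simp [pureTensor, tensorBasis, Module.Basis.tensorProduct_apply, MonoidAlgebra.basis_apply]
  rw [h, functionalPhi, Module.Basis.constr_basis]

/-- The cardinality of `I(A) ∩ B`, where `A` and `B` are the sets of occurrences of the letters
`c` and `d`. -/
noncomputable def crossCard (c d : Letter) : ℕ :=
  (succPsi w '' {x | letterAt w x = c} ∩ {x | letterAt w x = d}).ncard

end Occurrences

/-- The identification of the tensor products attached to two families of words that is induced
by bijections between the corresponding sets of occurrences of each letter
(a permutation `σ` is sent to `e σ e⁻¹`). -/
noncomputable def relabel {p p' : ℕ} {w : Fin p → Word} {w' : Fin p' → Word}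
    (e : ∀ c : Letter, OccOf w c ≃ OccOf w' c) : TensorAlg w →ₗ[ℂ] TensorAlg w' :=
  TensorProduct.map (TensorProduct.map (TensorProduct.map
    (MonoidAlgebra.mapDomainLinearMap ℂ ℂ (e letterU).permCongr)
    (MonoidAlgebra.mapDomainLinearMap ℂ ℂ (e letterUStar).permCongr))
    (MonoidAlgebra.mapDomainLinearMap ℂ ℂ (e letterV).permCongr))
    (MonoidAlgebra.mapDomainLinearMap ℂ ℂ (e letterVStar).permCongr)

end WordTrace

/-! Three ingredients carry the proof.

Gram inversion and Schur–Weyl duality. On the tensor power of `ℂ^N` indexed by `A`, the permutation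
operators have Gram matrix `N^{#(τσ⁻¹)}`, which is multiplication by `cycleElement`. For `|A| ≤ N`
these operators are independent, so `isUnit_cycleElement` holds. In the same range they span the
commutant of the unitary tensor powers (`eq_sum_perm_of_commute`). By Haar invariance the mixed
moments, as a matrix in the row indices, lie in this commutant. Unitarity determines their pairings
with permutations, and inverting the Gram matrix gives the Weingarten formula
`moment_eq_sum_weingarten`.

Trace expansion. The product of the `|Tr Wᵢ|²` is a sum over index functions `k` on `X` of products
of matrix entries. Fubini separates `U` from `V`, and the Weingarten formula turns each integral
into equality constraints on `k`. Together they say that `k` is constant on the cycles of `I ∘ (σu,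
θu, σv, θv)` (`indexCondition_iff`), so summing over `k` gives the coefficients of `R`.

Classification. `R` is built from `X`, its colouring by letters and `I` alone, and `I` is a
fixed-point-free involution. Such coloured involutions are classified by the counts of colour pairs
(`exists_equiv_of_involutive`), and an isomorphism between them carries one `R` to the other. -/

namespace WordTrace

/-! ### Gram matrix of the permutation operators -/

section Gram

variable {A : Type*}

theorem comp_perm_eq_of_sameCycle {β : Type*} {ρ : Equiv.Perm A} {i : A → β}
    (h : i ∘ ρ = i) {x y : A} (hxy : ρ.SameCycle x y) : i x = i y := by
  obtain ⟨n, rfl⟩ := hxy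
  have h1 : ∀ x, i (ρ x) = i x := fun x => congrFun h x
  induction n generalizing x with
  | zero => simp
  | succ n ih => rw [zpow_add_one, Equiv.Perm.mul_apply, ← ih, h1]
  | pred n ih =>
    rw [zpow_sub_one, Equiv.Perm.mul_apply, ← ih, ← h1 (ρ⁻¹ x)]; simp

/-- Functions invariant under a permutation are functions on the set of its cycles. -/
def invariantEquiv (β : Type*) (ρ : Equiv.Perm A) :
    {i : A → β // i ∘ ρ = i} ≃ (Quotient (Equiv.Perm.SameCycle.setoid ρ) → β) where
  toFun i := fun q => Quotient.lift i.1 (fun _ _ h => comp_perm_eq_of_sameCycle i.2 h) q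
  invFun f := ⟨fun x => f (Quotient.mk _ x), by
    funext x
    simp only [Function.comp]
    congr 1
    exact Quotient.sound (Equiv.Perm.sameCycle_apply_left.2 (Equiv.Perm.SameCycle.refl _ _))⟩
  left_inv i := rfl
  right_inv f := by
    funext q
    induction q using Quotient.ind
    rfl

theorem comp_perm_injective {β : Type*} {ι : A → β} (hι : ι.Injective) {σ τ : Equiv.Perm A}
    (h : ι ∘ σ = ι ∘ τ) : σ = τ :=
  Equiv.ext fun x => hι (congrFun h x)

variable [Fintype A] [DecidableEq A]

/-- An invariant index function is a free choice of one value per cycle. -/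
theorem sum_invariant (N : ℕ) (ρ : Equiv.Perm A) :
    (∑ i : A → Fin N, if i = i ∘ ρ then (1 : ℂ) else 0) = (N : ℂ) ^ numCycles ρ := by
  classical
  have h : Fintype.card {i : A → Fin N // i ∘ ρ = i} = N ^ numCycles ρ := by
    rw [← Nat.card_eq_fintype_card, Nat.card_congr (invariantEquiv (Fin N) ρ), Nat.card_fun]
    simp [numCycles]
  rw [← Nat.cast_pow, ← h, Fintype.card_subtype]
  simp [eq_comm]

theorem sum_comp_eq_comp (N : ℕ) (σ τ : Equiv.Perm A) :
    (∑ i : A → Fin N, if i ∘ τ = i ∘ σ then (1 : ℂ) else 0) =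
      (N : ℂ) ^ numCycles (τ * σ⁻¹) := by
  rw [← sum_invariant]
  refine Finset.sum_congr rfl fun i _ => ?_
  congr 1
  rw [eq_iff_iff]
  constructor
  · intro h
    funext x
    have := congrFun h (σ⁻¹ x)
    simpa using this.symm
  · intro h
    funext x
    have := congrFun h (σ x)
    simpa using this.symm

theorem coeff_cycleElement (N : ℕ) (σ : Equiv.Perm A) :
    (cycleElement N A).coeff σ = (N : ℂ) ^ numCycles σ := by
  simp [cycleElement, MonoidAlgebra.coeff_sum, Finsupp.finsetSum_apply, Finsupp.single_apply]

theorem coeff_mul_eq_sum {G : Type*} [Group G] [Fintype G] (x y : MonoidAlgebra ℂ G) (g : G) :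
    (x * y).coeff g = ∑ h : G, x.coeff (g * h⁻¹) * y.coeff h := by
  rw [MonoidAlgebra.coeff_mul_apply_right, Finsupp.sum_fintype]
  simp

theorem coeff_cycleElement_mul (N : ℕ) (c : MonoidAlgebra ℂ (Equiv.Perm A)) (τ : Equiv.Perm A) :
    (cycleElement N A * c).coeff τ = ∑ σ, (N : ℂ) ^ numCycles (τ * σ⁻¹) * c.coeff σ := by
  simp [coeff_mul_eq_sum, coeff_cycleElement]

/-- The Gram form at `c` is the squared Hilbert–Schmidt norm of the combination `s` of permutation
operators with coefficients `c`. It vanishes on the kernel, so `s = 0`, and independence of the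
operators gives `c = 0`. -/
theorem eq_zero_of_cycleElement_mul_eq_zero {N : ℕ} (hN : Fintype.card A ≤ N)
    {c : MonoidAlgebra ℂ (Equiv.Perm A)} (hc : cycleElement N A * c = 0) : c = 0 := by
  classical
  obtain ⟨ι⟩ : Nonempty (A ↪ Fin N) :=
    Function.Embedding.nonempty_of_card_le (by simpa using hN)
  set s : (A → Fin N) → (A → Fin N) → ℂ :=
    fun i k => ∑ σ : Equiv.Perm A, if k = i ∘ σ then c.coeff σ else 0 with hs
  have h0 : ∑ i, ∑ k, s i k * star (s i k) = 0 := by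
    calc ∑ i, ∑ k, s i k * star (s i k)
        = ∑ i : A → Fin N, ∑ τ : Equiv.Perm A, ∑ σ : Equiv.Perm A, (if i ∘ τ = i ∘ σ then 1 else 0) *
            (c.coeff σ * star (c.coeff τ)) := by
          refine Finset.sum_congr rfl fun i _ => ?_
          simp only [hs, star_sum, Finset.sum_mul_sum]
          rw [Finset.sum_comm]
          simp_rw [Finset.sum_comm (s := (Finset.univ : Finset (A → Fin N)))]
          rw [Finset.sum_comm]
          refine Finset.sum_congr rfl fun τ _ => Finset.sum_congr rfl fun σ _ => ?_
          simp only [apply_ite star, star_zero, mul_ite, mul_zero, ite_mul, zero_mul, one_mul]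
          simp
      _ = ∑ τ : Equiv.Perm A, star (c.coeff τ) * (cycleElement N A * c).coeff τ := by
          rw [Finset.sum_comm]
          refine Finset.sum_congr rfl fun τ _ => ?_
          rw [Finset.sum_comm, coeff_cycleElement_mul, Finset.mul_sum]
          refine Finset.sum_congr rfl fun σ _ => ?_
          rw [← Finset.sum_mul, sum_comp_eq_comp]
          ring
      _ = 0 := by simp [hc]
  have h1 : ∀ i k, s i k = 0 := by
    have h2 : ∑ i, ∑ k, ‖s i k‖ ^ 2 = 0 := by
      have : ((∑ i, ∑ k, ‖s i k‖ ^ 2 : ℝ) : ℂ) = 0 := by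
        rw [← h0]
        push_cast
        simp only [Complex.star_def, Complex.mul_conj']
      exact_mod_cast this
    intro i k
    rw [Finset.sum_eq_zero_iff_of_nonneg (fun _ _ => by positivity)] at h2
    have h3 := h2 i (Finset.mem_univ _)
    rw [Finset.sum_eq_zero_iff_of_nonneg (fun _ _ => by positivity)] at h3
    simpa using h3 k (Finset.mem_univ _)
  ext σ
  -- An injective index function separates permutations, so this entry of `s` is `c.coeff σ` alone.
  have h2 := h1 ι (ι ∘ σ)
  rw [hs] at h2
  simp only at h2
  rw [Finset.sum_eq_single σ] at h2
  · simpa using h2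
  · intro τ _ hτ
    rw [if_neg fun h => hτ (comp_perm_injective ι.injective h).symm]
  · simp

theorem isUnit_cycleElement {N : ℕ} (hN : Fintype.card A ≤ N) : IsUnit (cycleElement N A) := by
  have hinj : Function.Injective (LinearMap.mulLeft ℂ (cycleElement N A)) := by
    rw [injective_iff_map_eq_zero]
    exact fun c hc => eq_zero_of_cycleElement_mul_eq_zero hN hc
  have : Module.Finite ℂ (MonoidAlgebra ℂ (Equiv.Perm A)) :=
    Module.Finite.of_basis (MonoidAlgebra.basis (Equiv.Perm A) ℂ)
  obtain ⟨y, hy⟩ := LinearMap.surjective_of_injective hinj 1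
  have : IsNoetherianRing (MonoidAlgebra ℂ (Equiv.Perm A)) := inferInstance
  -- Surjectivity gives only a right inverse; in a Noetherian ring it is two-sided.
  exact IsUnit.of_mul_eq_one y hy

/-- Inversion of the Gram system `∑_σ N^{#(τσ⁻¹)} c_σ = d_τ`. -/
theorem eq_sum_weingarten {N : ℕ} (hN : Fintype.card A ≤ N) {c d : Equiv.Perm A → ℂ}
    (h : ∀ τ, ∑ σ, (N : ℂ) ^ numCycles (τ * σ⁻¹) * c σ = d τ) (σ : Equiv.Perm A) :
    c σ = ∑ τ, weingarten N (σ * τ⁻¹) * d τ := by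
  set c' : MonoidAlgebra ℂ (Equiv.Perm A) :=
    MonoidAlgebra.ofCoeff (Finsupp.equivFunOnFinite.symm c) with hc'
  set d' : MonoidAlgebra ℂ (Equiv.Perm A) :=
    MonoidAlgebra.ofCoeff (Finsupp.equivFunOnFinite.symm d) with hd'
  have h1 : cycleElement N A * c' = d' := by
    ext τ
    rw [coeff_cycleElement_mul]
    exact h τ
  have h2 : c' = Ring.inverse (cycleElement N A) * d' := by
    rw [← h1, ← mul_assoc, Ring.inverse_mul_cancel _ (isUnit_cycleElement hN), one_mul]
  have h3 : c σ = c'.coeff σ := rfl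
  rw [h3, h2, coeff_mul_eq_sum]
  rfl

end Gram

/-! ### Haar probability measure and integrability -/

section Haar

instance (N : ℕ) : (haarU N).IsHaarMeasure := by unfold haarU; infer_instance

instance (N : ℕ) : MeasureTheory.IsProbabilityMeasure (haarU N) :=
  ⟨by simpa [haarU] using MeasureTheory.Measure.haarMeasure_self (G := UGroup N) (K₀ := ⊤)⟩

theorem continuous_entry {N : ℕ} (i j : Fin N) : Continuous fun U : UGroup N => U.1 i j :=
  (continuous_apply j).comp ((continuous_apply i).comp continuous_subtype_val)

theorem integrable_of_continuous {N : ℕ} {f : UGroup N → ℂ} (hf : Continuous f) :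
    MeasureTheory.Integrable f (haarU N) :=
  hf.integrable_of_hasCompactSupport (HasCompactSupport.of_compactSpace f)

end Haar

/-! ### Schur–Weyl duality and the Weingarten formula -/

section TensorPower

variable {A : Type*} [Fintype A] {N : ℕ}

/-- The matrix of the tensor power `M^{⊗A}` in the standard basis. -/
def tensorPow (A : Type*) [Fintype A] (M : Matrix (Fin N) (Fin N) ℂ) :
    Matrix (A → Fin N) (A → Fin N) ℂ :=
  Matrix.of fun i j => ∏ a, M (i a) (j a)

theorem tensorPow_mul [DecidableEq A] (M M' : Matrix (Fin N) (Fin N) ℂ) :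
    tensorPow A (M * M') = tensorPow A M * tensorPow A M' := by
  ext i j
  simp only [tensorPow, Matrix.of_apply, Matrix.mul_apply, Finset.prod_univ_sum,
    Finset.prod_mul_distrib, Fintype.piFinset_univ]

theorem tensorPow_diagonal (d : Fin N → ℂ) :
    tensorPow A (Matrix.diagonal d) = Matrix.diagonal fun i => ∏ a, d (i a) := by
  ext i j
  simp only [tensorPow, Matrix.of_apply, Matrix.diagonal_apply]
  split_ifs with h
  · simp [h]
  · obtain ⟨a, ha⟩ := Function.ne_iff.1 h
    exact Finset.prod_eq_zero (Finset.mem_univ a) (by simp [ha])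

theorem tensorPow_one [DecidableEq A] : tensorPow A (1 : Matrix (Fin N) (Fin N) ℂ) = 1 := by
  rw [← Matrix.diagonal_one, tensorPow_diagonal]
  simp

theorem tensorPow_star (M : Matrix (Fin N) (Fin N) ℂ) :
    tensorPow A (star M) = star (tensorPow A M) := by
  ext i j
  simp [tensorPow, Matrix.star_apply]

theorem exists_perm_of_card_fiber_eq [DecidableEq A] {i i' : A → Fin N}
    (h : ∀ m, (Finset.univ.filter fun a => i a = m).card =
      (Finset.univ.filter fun a => i' a = m).card) :
    ∃ σ : Equiv.Perm A, i = i' ∘ σ := by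
  have e : ∀ m, Nonempty ({a // i a = m} ≃ {a // i' a = m}) := fun m =>
    ⟨Fintype.equivOfCardEq (by rw [Fintype.card_subtype, Fintype.card_subtype, h])⟩
  let e' := fun m => (e m).some
  exact ⟨Equiv.ofFiberEquiv e', funext fun a => (Equiv.ofFiberEquiv_map e' a).symm⟩

theorem prod_ite_one {z : ℂ} (i : A → Fin N) (m : Fin N) :
    (∏ a, if i a = m then z else 1) = z ^ (Finset.univ.filter fun a => i a = m).card := by
  rw [Finset.prod_ite]
  simp

/-- A matrix commuting with the tensor powers of diagonal unitaries preserves weights. -/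
theorem exists_perm_of_commute [DecidableEq A] {T : Matrix (A → Fin N) (A → Fin N) ℂ}
    (hT : ∀ U : UGroup N, Commute (tensorPow A U.1) T) {i i' : A → Fin N} (h : T i i' ≠ 0) :
    ∃ σ : Equiv.Perm A, i = i' ∘ σ := by
  refine exists_perm_of_card_fiber_eq fun m => ?_
  set n := Fintype.card A
  -- The fibre sizes to be compared lie in `0, …, n`, so a root of unity of order `n + 1` separates
  -- their powers.
  have hz := Complex.isPrimitiveRoot_exp (n + 1) (by omega)
  set z := Complex.exp (2 * Real.pi * Complex.I / ((n + 1 : ℕ) : ℂ))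
  have hz1 : ‖z‖ = 1 := hz.norm'_eq_one (by omega)
  have hmem : Matrix.diagonal (fun k : Fin N => if k = m then z else 1) ∈
      Matrix.unitaryGroup (Fin N) ℂ := by
    rw [Matrix.mem_unitaryGroup_iff, Matrix.star_eq_conjTranspose,
      Matrix.diagonal_conjTranspose, Matrix.diagonal_mul_diagonal, ← Matrix.diagonal_one]
    congr 1
    funext k
    by_cases hk : k = m
    · simp [hk, Complex.mul_conj', hz1]
    · simp [hk]
  have h1 := congrFun (congrFun (hT ⟨_, hmem⟩).eq i) i'
  simp only [tensorPow_diagonal, Matrix.diagonal_mul, Matrix.mul_diagonal, prod_ite_one] at h1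
  rw [mul_comm] at h1
  exact hz.pow_inj (Nat.lt_succ_of_le (Finset.card_le_univ _))
    (Nat.lt_succ_of_le (Finset.card_le_univ _)) (mul_left_cancel₀ h h1)

theorem commute_tensorPow_diagonal [DecidableEq A] {T : Matrix (A → Fin N) (A → Fin N) ℂ}
    (hT : ∀ U : UGroup N, Commute (tensorPow A U.1) T) (d : Fin N → ℂ) :
    Commute (tensorPow A (Matrix.diagonal d)) T := by
  ext i i'
  rw [tensorPow_diagonal, Matrix.diagonal_mul, Matrix.mul_diagonal]
  by_cases h : T i i' = 0
  · simp [h]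
  · obtain ⟨σ, rfl⟩ := exists_perm_of_commute hT h
    rw [mul_comm]
    congr 1
    exact Equiv.prod_comp σ fun a => d (i' a)

/-- The matrix of a map between basis vectors. -/
def mapMatrix (φ : Fin N → Fin N) : Matrix (Fin N) (Fin N) ℂ :=
  Matrix.of fun m m' => if m = φ m' then 1 else 0

/-- The matrix of a map is a diagonal matrix times a unitary one. -/
theorem exists_mapMatrix_eq (φ : Fin N → Fin N) :
    ∃ (d : Fin N → ℂ) (U : UGroup N), mapMatrix φ = Matrix.diagonal d * U.1 := by
  -- The rows of `mapMatrix φ` are indicators of the disjoint fibres of `φ`, hence orthogonal, with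
  -- norms `r k`. The nonzero rows, normalized and completed to an orthonormal basis, are the rows
  -- of the unitary matrix.
  set r : Fin N → ℝ := fun k => Real.sqrt (Finset.univ.filter fun m => k = φ m).card with hr
  set v : Fin N → EuclideanSpace ℂ (Fin N) := fun k =>
    WithLp.toLp 2 fun m => if k = φ m then ((r k)⁻¹ : ℂ) else 0 with hv
  have hpos : ∀ k ∈ Set.range φ, 0 < r k := by
    rintro _ ⟨m, rfl⟩
    refine Real.sqrt_pos.2 ?_
    exact_mod_cast Finset.card_pos.2 ⟨m, by simp⟩
  have hrr : ∀ k, (r k : ℂ) * r k = (Finset.univ.filter fun m => k = φ m).card := by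
    intro k
    rw [← Complex.ofReal_mul, hr, Real.mul_self_sqrt (by positivity)]
    simp
  have horth : Orthonormal ℂ ((Set.range φ).domRestrict v) := by
    rw [orthonormal_iff_ite]
    rintro ⟨k, hk⟩ ⟨l, hl⟩
    simp only [Set.domRestrict_apply, Subtype.mk.injEq, hv, PiLp.inner_apply, RCLike.inner_apply]
    split_ifs with h
    · subst h
      have h0 : (r k : ℂ) ≠ 0 := by exact_mod_cast (hpos k hk).ne'
      simp only [apply_ite (starRingEnd ℂ), map_zero, mul_ite, ite_mul, mul_zero, zero_mul,
        map_inv₀, Complex.conj_ofReal]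
      rw [← Finset.sum_filter, ← Finset.sum_filter, Finset.filter_filter]
      simp only [and_self, Finset.sum_const, nsmul_eq_mul, ← hrr]
      field_simp
    · refine Finset.sum_eq_zero fun m _ => ?_
      by_cases h1 : k = φ m
      · have h2 : ¬ l = φ m := fun h2 => h (h1.trans h2.symm)
        simp [h2]
      · simp [h1]
  obtain ⟨b, hb⟩ := horth.exists_orthonormalBasis_extension_of_card_eq (by simp)
  have hU : Matrix.of (fun k m => b k m) ∈ Matrix.unitaryGroup (Fin N) ℂ := by
    rw [Matrix.mem_unitaryGroup_iff]
    ext k l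
    have := orthonormal_iff_ite.1 b.orthonormal l k
    simp only [PiLp.inner_apply, RCLike.inner_apply] at this
    rw [Matrix.mul_apply, Matrix.one_apply]
    simp only [Matrix.star_apply, Matrix.of_apply, RCLike.star_def]
    rw [this]
    simp [eq_comm]
  refine ⟨fun k => r k, ⟨_, hU⟩, ?_⟩
  ext k m
  rw [Matrix.diagonal_mul]
  simp only [mapMatrix, Matrix.of_apply]
  by_cases hk : k ∈ Set.range φ
  · have h0 : (r k : ℂ) ≠ 0 := by exact_mod_cast (hpos k hk).ne'
    rw [hb k hk]
    simp only [hv]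
    split_ifs with h
    · field_simp
    · simp
  -- Outside the range `r k = 0`, so the diagonal factor kills the arbitrary completing row.
  · have h1 : ∀ m, ¬ k = φ m := fun m h => hk ⟨m, h.symm⟩
    simp [h1, hr]

theorem commute_tensorPow_mapMatrix [DecidableEq A] {T : Matrix (A → Fin N) (A → Fin N) ℂ}
    (hT : ∀ U : UGroup N, Commute (tensorPow A U.1) T) (φ : Fin N → Fin N) :
    Commute (tensorPow A (mapMatrix φ)) T := by
  obtain ⟨d, U, h⟩ := exists_mapMatrix_eq φ
  rw [h, tensorPow_mul]
  exact (commute_tensorPow_diagonal hT d).mul_left (hT U)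

theorem tensorPow_mapMatrix (φ : Fin N → Fin N) (i j : A → Fin N) :
    tensorPow A (mapMatrix φ) i j = if i = φ ∘ j then 1 else 0 := by
  simp only [tensorPow, mapMatrix, Matrix.of_apply]
  rw [Finset.prod_ite_zero]
  simp [funext_iff]

/-- Schur–Weyl duality in the stable range: the commutant of the tensor powers of unitary
matrices is spanned by permutation operators. -/
theorem eq_sum_perm_of_commute [DecidableEq A] {T : Matrix (A → Fin N) (A → Fin N) ℂ}
    (hT : ∀ U : UGroup N, Commute (tensorPow A U.1) T) {ι : A → Fin N} (hι : ι.Injective)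
    (i i' : A → Fin N) :
    T i i' = ∑ σ : Equiv.Perm A, T (ι ∘ σ) ι * if i = i' ∘ σ then 1 else 0 := by
  -- Any column `i'` is the image of the column `ι` under some `φ`, so commuting with `mapMatrix φ`
  -- reduces `T` to that one column. The values of `φ` off the range of `ι` are irrelevant.
  obtain ⟨φ, hφ⟩ : ∃ φ : Fin N → Fin N, i' = φ ∘ ι :=
    ⟨fun m => Function.extend ι i' id m, by
      funext a; simp [hι.extend_apply]⟩
  have h := congrFun (congrFun (commute_tensorPow_mapMatrix hT φ).eq i) ι
  simp only [Matrix.mul_apply, tensorPow_mapMatrix, mul_ite, mul_one, mul_zero] at h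
  rw [Finset.sum_ite_eq' Finset.univ (φ ∘ ι), if_pos (Finset.mem_univ _), ← hφ] at h
  rw [← h]
  have hinj : Function.Injective fun σ : Equiv.Perm A => ι ∘ σ :=
    fun σ τ h => comp_perm_injective hι h
  symm
  refine Finset.sum_of_injOn (fun σ : Equiv.Perm A => ι ∘ σ) hinj.injOn (by simp) ?_ ?_
  -- Weight preservation: the column `ι` is supported on the rearrangements of `ι`.
  · intro k _ hk
    by_cases h0 : T k ι = 0
    · simp [h0]
    · obtain ⟨σ, rfl⟩ := exists_perm_of_commute hT h0
      exact absurd ⟨σ, by simp⟩ hk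
  · intro σ _
    simp [hφ, Function.comp_assoc]

/-- The mixed moments of the entries of a Haar unitary matrix. -/
noncomputable def moment (i j i' j' : A → Fin N) : ℂ :=
  ∫ U : UGroup N, (∏ a, U.1 (i a) (j a)) * ∏ a, star (U.1 (i' a) (j' a)) ∂(haarU N)

theorem continuous_moment_integrand (i j i' j' : A → Fin N) :
    Continuous fun U : UGroup N => (∏ a, U.1 (i a) (j a)) * ∏ a, star (U.1 (i' a) (j' a)) :=
  (continuous_finsetProd _ fun _ _ => continuous_entry _ _).mul
    (continuous_finsetProd _ fun _ _ => (continuous_entry _ _).star)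

/-- Invariance of Haar measure under `U ↦ V * U` says that conjugation by the tensor power of `V`
fixes this matrix. -/
theorem commute_moment [DecidableEq A] (j j' : A → Fin N) (V : UGroup N) :
    Commute (tensorPow A V.1) (Matrix.of fun i i' : A → Fin N => moment i j i' j') := by
  set T : Matrix (A → Fin N) (A → Fin N) ℂ := Matrix.of fun i i' => moment i j i' j' with hTdef
  have hV : star (tensorPow A V.1) * tensorPow A V.1 = 1 := by
    rw [← tensorPow_star, ← tensorPow_mul, Matrix.UnitaryGroup.star_mul_self, tensorPow_one]
  have key : tensorPow A V.1 * T * star (tensorPow A V.1) = T := by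
    ext i i'
    simp only [Matrix.mul_apply, Matrix.star_apply, Finset.sum_mul, hTdef, Matrix.of_apply]
    conv_rhs => rw [moment, ← MeasureTheory.integral_mul_left_eq_self _ V]
    have hexp : ∀ U : UGroup N, (∏ a, (V * U).1 (i a) (j a)) * ∏ a, star ((V * U).1 (i' a) (j' a))
        = ∑ x, ∑ y, tensorPow A V.1 i y * ((∏ a, U.1 (y a) (j a)) *
          ∏ a, star (U.1 (x a) (j' a))) * star (tensorPow A V.1 i' x) := by
      intro U
      have h1 := congrFun (congrFun (tensorPow_mul (A := A) V.1 U.1) i) j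
      have h2 := congrArg star (congrFun (congrFun (tensorPow_mul (A := A) V.1 U.1) i') j')
      simp only [Matrix.mul_apply, star_sum, star_mul] at h1 h2
      have h3 : (∏ a, (V * U).1 (i a) (j a)) = tensorPow A (V.1 * U.1) i j := rfl
      have h4 : (∏ a, star ((V * U).1 (i' a) (j' a))) =
          star (tensorPow A (V.1 * U.1) i' j') := (star_prod _ _).symm
      rw [h3, h4, h1, h2, Finset.mul_sum]
      refine Finset.sum_congr rfl fun x _ => ?_
      rw [Finset.sum_mul]
      refine Finset.sum_congr rfl fun y _ => ?_
      simp only [tensorPow, Matrix.of_apply, star_prod]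
      ring
    simp_rw [hexp]
    rw [MeasureTheory.integral_finsetSum]
    · refine Finset.sum_congr rfl fun x _ => ?_
      rw [MeasureTheory.integral_finsetSum]
      · refine Finset.sum_congr rfl fun y _ => ?_
        rw [MeasureTheory.integral_mul_const, MeasureTheory.integral_const_mul]
        rfl
      · exact fun y _ => integrable_of_continuous
          ((continuous_const.mul (continuous_moment_integrand _ _ _ _)).mul continuous_const)
    · exact fun x _ => integrable_of_continuous (continuous_finsetSum _ fun y _ =>
        ((continuous_const.mul (continuous_moment_integrand _ _ _ _)).mul continuous_const))
  calc tensorPow A V.1 * T = tensorPow A V.1 * T * (star (tensorPow A V.1) * tensorPow A V.1) := by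
        rw [hV, mul_one]
    _ = T * tensorPow A V.1 := by rw [← mul_assoc, key]

/-- After moving `τ` to the column index, the integrand is an entry of the tensor power of `U* U =
1`, hence constant in `U`. This is the right-hand side of the Gram system. -/
theorem sum_moment [DecidableEq A] (j j' : A → Fin N) (τ : Equiv.Perm A) :
    ∑ i : A → Fin N, moment (i ∘ τ) j i j' = if j = j' ∘ τ then 1 else 0 := by
  have h : ∀ U : UGroup N, (∑ i : A → Fin N, (∏ a, U.1 ((i ∘ τ) a) (j a)) *
      ∏ a, star (U.1 (i a) (j' a))) = if j = j' ∘ τ then 1 else 0 := by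
    intro U
    have h1 : ∀ i : A → Fin N, (∏ a, U.1 ((i ∘ τ) a) (j a)) * ∏ a, star (U.1 (i a) (j' a)) =
        star (tensorPow A U.1) j' i * tensorPow A U.1 i (j ∘ τ.symm) := by
      intro i
      rw [mul_comm]
      congr 1
      · simp [tensorPow, Matrix.star_apply]
      · rw [← Equiv.prod_comp τ.symm]
        simp [tensorPow]
    simp_rw [h1]
    rw [← Matrix.mul_apply, ← tensorPow_star, ← tensorPow_mul,
      Matrix.UnitaryGroup.star_mul_self, tensorPow_one, Matrix.one_apply]
    congr 1
    rw [eq_iff_iff]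
    constructor
    · rintro rfl
      ext; simp
    · rintro rfl
      ext; simp
  simp only [moment]
  rw [← MeasureTheory.integral_finsetSum]
  · simp_rw [h]
    simp
  · exact fun i _ => integrable_of_continuous (continuous_moment_integrand _ _ _ _)

/-- The Weingarten formula. -/
theorem moment_eq_sum_weingarten [DecidableEq A] (hN : Fintype.card A ≤ N) (i j i' j' : A → Fin N) :
    moment i j i' j' = ∑ σ : Equiv.Perm A, ∑ τ : Equiv.Perm A, weingarten N (σ * τ⁻¹) *
      ((if i = i' ∘ σ then 1 else 0) * if j = j' ∘ τ then 1 else 0) := by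
  obtain ⟨ι⟩ : Nonempty (A ↪ Fin N) :=
    Function.Embedding.nonempty_of_card_le (by simpa using hN)
  have hexp := fun i i' : A → Fin N =>
    eq_sum_perm_of_commute (commute_moment j j') ι.injective i i'
  simp only [Matrix.of_apply] at hexp
  -- Substituting the Schur–Weyl expansion into `sum_moment` gives a Gram system for its
  -- coefficients.
  have hsys : ∀ τ : Equiv.Perm A, ∑ σ : Equiv.Perm A, (N : ℂ) ^ numCycles (τ * σ⁻¹) *
      moment (ι ∘ σ) j ι j' = if j = j' ∘ τ then 1 else 0 := by
    intro τ
    rw [← sum_moment]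
    rw [Finset.sum_congr rfl fun i _ => hexp (i ∘ τ) i]
    rw [Finset.sum_comm]
    refine Finset.sum_congr rfl fun σ _ => ?_
    rw [← Finset.mul_sum, sum_comp_eq_comp, mul_comm]
  rw [hexp i i']
  refine Finset.sum_congr rfl fun σ _ => ?_
  rw [eq_sum_weingarten hN hsys σ, Finset.sum_mul]
  refine Finset.sum_congr rfl fun τ _ => ?_
  ring

end TensorPower

/-! ### Classification of coloured fixed-point-free involutions -/

section Involutions

variable {X X' L : Type*}

/-- A choice of one point in every orbit of a fixed-point-free involution of a coloured set, such
that the number of chosen points with given colours of the orbit is determined by the numbers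
of all points with given colours. -/
theorem exists_transversal [Finite X] (f : X → L) (g : L → ℕ) (hg : g.Injective)
    (I : Equiv.Perm X) (hI : Function.Involutive I) (hfix : ∀ x, I x ≠ x) :
    ∃ s : X → Prop, (∀ x, s (I x) ↔ ¬ s x) ∧ ∀ c d, Nat.card {x // s x ∧ f x = c ∧ f (I x) = d} =
      if g c < g d then Nat.card {x // f x = c ∧ f (I x) = d}
      else if g d < g c then 0 else Nat.card {x // f x = c ∧ f (I x) = d} / 2 := by
  classical
  obtain ⟨n, ⟨idx⟩⟩ := Finite.exists_equiv_fin X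
  -- A lexicographic key, colour first and then position. The point of smaller key is chosen in each
  -- orbit, so an orbit with two colours contributes its point of smaller colour.
  set k : X → ℕ := fun x => g (f x) * n + idx x with hk
  have hlt : ∀ x y, g (f x) < g (f y) → k x < k y := by
    intro x y h
    have h1 := (idx x).isLt
    have h2 : (g (f x) + 1) * n ≤ g (f y) * n := Nat.mul_le_mul_right n h
    have h3 : (g (f x) + 1) * n = g (f x) * n + n := by ring
    simp only [hk]
    omega
  have hinj : ∀ x y, k x = k y → x = y := by
    intro x y h
    have h0 : g (f x) = g (f y) := by
      rcases lt_trichotomy (g (f x)) (g (f y)) with h1 | h1 | h1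
      · exact absurd h (hlt _ _ h1).ne
      · exact h1
      · exact absurd h (hlt _ _ h1).ne'
    simp only [hk, h0] at h
    exact idx.injective (Fin.ext (by omega))
  have hs : ∀ x, k (I x) < k (I (I x)) ↔ ¬ k x < k (I x) := by
    intro x
    rw [hI x]
    have : k (I x) ≠ k x := fun h => hfix x (hinj _ _ h)
    omega
  refine ⟨fun x => k x < k (I x), hs, fun c d => ?_⟩
  split_ifs with h1 h2
  · refine Nat.card_congr (Equiv.subtypeEquivRight fun x => ?_)
    constructor
    · exact fun h => h.2
    · rintro ⟨rfl, rfl⟩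
      exact ⟨hlt _ _ h1, rfl, rfl⟩
  · rw [Nat.card_eq_zero]
    left
    constructor
    rintro ⟨x, hx, rfl, rfl⟩
    exact absurd (hlt _ _ h2) (by omega)
  · obtain rfl : c = d := hg (by omega)
    -- Within one colour, `I` exchanges the chosen and the unchosen points, so exactly half are
    -- chosen.
    have e1 : {x // f x = c ∧ f (I x) = c} ≃ {x // k x < k (I x) ∧ f x = c ∧ f (I x) = c} ⊕
        {x // ¬ k x < k (I x) ∧ f x = c ∧ f (I x) = c} :=
      (Equiv.sumCompl fun y : {x // f x = c ∧ f (I x) = c} => k y < k (I y)).symm.trans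
        (Equiv.sumCongr
          ((Equiv.subtypeSubtypeEquivSubtypeInter _ fun x => k x < k (I x)).trans
            (Equiv.subtypeEquivRight fun x => and_comm))
          ((Equiv.subtypeSubtypeEquivSubtypeInter _ fun x => ¬ k x < k (I x)).trans
            (Equiv.subtypeEquivRight fun x => and_comm)))
    have e2 : {x // k x < k (I x) ∧ f x = c ∧ f (I x) = c} ≃
        {x // ¬ k x < k (I x) ∧ f x = c ∧ f (I x) = c} :=
      I.subtypeEquiv fun x => by
        rw [hs, hI x, not_not]
        tauto
    rw [Nat.card_congr e1, Nat.card_sum, ← Nat.card_congr e2, ← two_mul,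
      Nat.mul_div_cancel_left _ two_pos]

/-- The equivariant extension of a map defined on a transversal. -/
noncomputable def extendInvolution (s : X → Prop) (I : Equiv.Perm X) (I' : Equiv.Perm X')
    (hs : ∀ x, s (I x) ↔ ¬ s x) (F : {x // s x} → X') (x : X) : X' :=
  open scoped Classical in
  if h : s x then F ⟨x, h⟩ else I' (F ⟨I x, (hs x).2 h⟩)

theorem extendInvolution_of_mem {s : X → Prop} {I : Equiv.Perm X} {I' : Equiv.Perm X'}
    {hs : ∀ x, s (I x) ↔ ¬ s x} {F : {x // s x} → X'} (x : {x // s x}) :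
    extendInvolution s I I' hs F x = F x := by
  simp [extendInvolution, x.2]

theorem extendInvolution_apply {s : X → Prop} {I : Equiv.Perm X} {I' : Equiv.Perm X'}
    {hs : ∀ x, s (I x) ↔ ¬ s x} {F : {x // s x} → X'} (hI : Function.Involutive I)
    (hI' : Function.Involutive I') (x : X) :
    extendInvolution s I I' hs F (I x) = I' (extendInvolution s I I' hs F x) := by
  have h1 := hs x
  by_cases h : s x
  · have h2 : ¬ s (I x) := by tauto
    simp only [extendInvolution, h, h2, dif_pos, dif_neg, not_false_eq_true, hI x]
  · have h2 : s (I x) := by tauto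
    simp only [extendInvolution, h, h2, dif_pos, dif_neg, not_false_eq_true, hI' _]

/-- On the transversal this is `F.symm (F x) = x`; equivariance carries it to the other half.
Exchanging the roles of the two sides gives the right inverse too. -/
theorem extendInvolution_leftInverse {s : X → Prop} {s' : X' → Prop} {I : Equiv.Perm X}
    {I' : Equiv.Perm X'} (hs : ∀ x, s (I x) ↔ ¬ s x) (hs' : ∀ x, s' (I' x) ↔ ¬ s' x)
    (hI : Function.Involutive I) (hI' : Function.Involutive I') (F : {x // s x} ≃ {x // s' x}) :
    Function.LeftInverse (extendInvolution s' I' I hs' fun x => F.symm x)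
      (extendInvolution s I I' hs fun x => F x) := by
  have key : ∀ x : {x // s x}, extendInvolution s' I' I hs' (fun x => F.symm x)
      (extendInvolution s I I' hs (fun x => F x) x) = x := by
    intro x
    rw [extendInvolution_of_mem, extendInvolution_of_mem, Equiv.symm_apply_apply]
  intro x
  by_cases h : s x
  · exact key ⟨x, h⟩
  · have h1 := key ⟨I x, (hs x).2 h⟩
    rw [extendInvolution_apply hI hI', extendInvolution_apply hI' hI] at h1
    exact I.injective h1

/-- Fixed-point-free involutions of coloured finite sets are classified by the numbers of points
with given colours of the point and of its image. -/
theorem exists_equiv_of_involutive [Finite X] [Finite X'] [Countable L] (f : X → L) (f' : X' → L)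
    (I : Equiv.Perm X) (I' : Equiv.Perm X') (hI : Function.Involutive I)
    (hI' : Function.Involutive I') (hfix : ∀ x, I x ≠ x) (hfix' : ∀ x, I' x ≠ x)
    (hcard : ∀ c d, Nat.card {x // f x = c ∧ f (I x) = d} =
      Nat.card {x // f' x = c ∧ f' (I' x) = d}) :
    ∃ E : X ≃ X', (∀ x, f' (E x) = f x) ∧ ∀ x, E (I x) = I' (E x) := by
  obtain ⟨g, hg⟩ := exists_injective_nat L
  obtain ⟨s, hs, hc⟩ := exists_transversal f g hg I hI hfix
  obtain ⟨s', hs', hc'⟩ := exists_transversal f' g hg I' hI' hfix'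
  have e : ∀ q : L × L, Nonempty ({x : {x // s x} // (f x, f (I x)) = q} ≃
      {x : {x // s' x} // (f' x, f' (I' x)) = q}) := by
    rintro ⟨c, d⟩
    have h : Nat.card {x // s x ∧ f x = c ∧ f (I x) = d} =
        Nat.card {x // s' x ∧ f' x = c ∧ f' (I' x) = d} := by
      rw [hc, hc', hcard]
    obtain ⟨e⟩ := (Finite.card_eq.1 h)
    refine ⟨?_⟩
    simp only [Prod.mk.injEq]
    exact ((Equiv.subtypeSubtypeEquivSubtypeInter _ fun x => f x = c ∧ f (I x) = d).trans e).trans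
      (Equiv.subtypeSubtypeEquivSubtypeInter _ fun x => f' x = c ∧ f' (I' x) = d).symm
  -- Matching both colours of each orbit, not only that of the chosen point, makes the equivariant
  -- extension preserve colours everywhere.
  set F : {x // s x} ≃ {x // s' x} := Equiv.ofFiberEquiv fun q => (e q).some with hF
  have hFf : ∀ x : {x // s x}, (f' (F x), f' (I' (F x))) = (f x, f (I x)) :=
    fun x => Equiv.ofFiberEquiv_map (fun q => (e q).some) x
  refine ⟨⟨_, _, extendInvolution_leftInverse hs hs' hI hI' F,
    extendInvolution_leftInverse hs' hs hI' hI F.symm⟩, fun x => ?_,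
    fun x => by simpa only [Equiv.coe_fn_mk] using extendInvolution_apply hI hI' x⟩
  simp only [Equiv.coe_fn_mk]
  by_cases h : s x
  · rw [extendInvolution_of_mem ⟨x, h⟩]
    exact congrArg Prod.fst (hFf ⟨x, h⟩)
  · have h1 : extendInvolution s I I' hs (fun x => ↑(F x)) x = I' (F ⟨I x, (hs x).2 h⟩) := by
      simp [extendInvolution, h]
    rw [h1]
    have := congrArg Prod.snd (hFf ⟨I x, (hs x).2 h⟩)
    simpa [hI x] using this

end Involutions

/-! ### Cycle counts and extensions under conjugation -/

section Cycles

variable {α β : Type*}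

theorem permCongr_zpow (E : α ≃ β) (σ : Equiv.Perm α) (n : ℤ) :
    E.permCongr σ ^ n = E.permCongr (σ ^ n) :=
  (map_zpow E.permCongrHom σ n).symm

theorem numCycles_permCongr (E : α ≃ β) (σ : Equiv.Perm α) :
    numCycles (E.permCongr σ) = numCycles σ := by
  refine (Nat.card_congr (Quotient.congr E fun x y => ?_)).symm
  change σ.SameCycle x y ↔ (E.permCongr σ).SameCycle (E x) (E y)
  simp [Equiv.Perm.SameCycle, permCongr_zpow, Equiv.permCongr_apply]

theorem ofSubtype_permCongr {p : α → Prop} {q : β → Prop} [DecidablePred p] [DecidablePred q]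
    (E : α ≃ β) (h : ∀ x, p x ↔ q (E x)) (σ : Equiv.Perm {x // p x}) :
    Equiv.Perm.ofSubtype ((E.subtypeEquiv h).permCongr σ) =
      E.permCongr (Equiv.Perm.ofSubtype σ) := by
  ext y
  obtain ⟨x, rfl⟩ := E.surjective y
  by_cases hx : p x
  · rw [Equiv.Perm.ofSubtype_apply_of_mem _ ((h x).1 hx)]
    simp [Equiv.permCongr_apply, Equiv.Perm.ofSubtype_apply_of_mem _ hx, Equiv.subtypeEquiv_apply]
  · rw [Equiv.Perm.ofSubtype_apply_of_not_mem _ fun h' => hx ((h x).2 h')]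
    simp [Equiv.permCongr_apply, Equiv.Perm.ofSubtype_apply_of_not_mem _ hx]

end Cycles

/-! ### Dependence of `R` on the cross cardinalities only -/

section Relabel

variable {p : ℕ} (w : Fin p → Word)

theorem succOcc_apply (q : Fin p × Bool) (x : Fin (wordAt w q).length) :
    succOcc w ⟨q, x⟩ = ⟨q, finRotate _ x⟩ := rfl

theorem psi_apply (x : Occ w) : psi w x = psiFun w x := rfl

theorem val_finRotate {n : ℕ} (x : Fin n) :
    (finRotate n x).val = if x.val + 1 = n then 0 else x.val + 1 := by
  cases n with
  | zero => exact x.elim0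
  | succ n =>
    split_ifs with h
    · obtain rfl : x = Fin.last n := Fin.ext (by simpa using h)
      simp
    · rw [coe_finRotate_of_ne_last fun h' => h (by simp [h'])]

/-- In a word of length `n`, position `k` goes to `-k` modulo `n` in the inverse word; the split
cases are the wrap-around at `k = 0`. -/
theorem succPsi_involutive : Function.Involutive (succPsi w) := by
  rintro ⟨⟨i, b⟩, k⟩
  refine occ_ext w ?_ ?_
  · simp [succPsi, psi_apply, psiFun, succOcc_apply]
  · have h := length_wordAt_not w i b
    have h' := length_wordAt_not w i (!b)
    have hk := k.isLt
    simp only [succPsi, Equiv.Perm.mul_apply, psi_apply, psiFun, succOcc_apply, val_finRotate,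
      Fin.val_cast, Fin.val_rev]
    simp only [Bool.not_not] at h' ⊢
    split_ifs <;> omega

/-- `I` always passes from a word to its inverse word, which carries a different index. -/
theorem succPsi_ne (x : Occ w) : succPsi w x ≠ x := by
  intro h
  have := congrArg (fun y : Occ w => y.1.2) h
  simp [succPsi, psi_apply, psiFun, succOcc] at this

theorem crossCard_eq (c d : Letter) :
    crossCard w c d = Nat.card {x // letterAt w x = c ∧ letterAt w (succPsi w x) = d} := by
  rw [crossCard, ← Set.image_inter_preimage, Set.ncard_image_of_injective _ (succPsi w).injective]
  rfl

theorem concat_permCongr {p' : ℕ} {w : Fin p → Word} {w' : Fin p' → Word} (E : Occ w ≃ Occ w')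
    (h : ∀ c x, letterAt w x = c ↔ letterAt w' (E x) = c)
    (σu : Equiv.Perm (OccOf w letterU)) (θu : Equiv.Perm (OccOf w letterUStar))
    (σv : Equiv.Perm (OccOf w letterV)) (θv : Equiv.Perm (OccOf w letterVStar)) :
    concat w' ((E.subtypeEquiv (h _)).permCongr σu) ((E.subtypeEquiv (h _)).permCongr θu)
      ((E.subtypeEquiv (h _)).permCongr σv) ((E.subtypeEquiv (h _)).permCongr θv) =
      E.permCongr (concat w σu θu σv θv) := by
  simp only [concat, ofSubtype_permCongr, Equiv.permCongr_mul]

theorem relabel_pureTensor {p' : ℕ} {w : Fin p → Word} {w' : Fin p' → Word}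
    (e : ∀ c : Letter, OccOf w c ≃ OccOf w' c)
    (σu : Equiv.Perm (OccOf w letterU)) (θu : Equiv.Perm (OccOf w letterUStar))
    (σv : Equiv.Perm (OccOf w letterV)) (θv : Equiv.Perm (OccOf w letterVStar)) :
    relabel e (pureTensor w σu θu σv θv) = pureTensor w' ((e _).permCongr σu)
      ((e _).permCongr θu) ((e _).permCongr σv) ((e _).permCongr θv) := by
  simp [relabel, pureTensor]

theorem exists_relabel_elementR {p' : ℕ} (w' : Fin p' → Word) (N : ℕ)
    (h : ∀ c d : Letter, crossCard w c d = crossCard w' c d) :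
    ∃ e : ∀ c : Letter, OccOf w c ≃ OccOf w' c, relabel e (elementR w N) = elementR w' N := by
  simp only [crossCard_eq] at h
  obtain ⟨E, hE, hEI⟩ := exists_equiv_of_involutive (letterAt w) (letterAt w') (succPsi w)
    (succPsi w') (succPsi_involutive w) (succPsi_involutive w') (succPsi_ne w) (succPsi_ne w') h
  have hE' : ∀ c x, letterAt w x = c ↔ letterAt w' (E x) = c := fun c x => by rw [hE]
  -- Conjugation by `E` thus carries the whole permutation in the exponent, `I` included, and
  -- preserves its cycle count.
  have hI : succPsi w' = E.permCongr (succPsi w) := by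
    refine Equiv.ext fun y => ?_
    obtain ⟨x, rfl⟩ := E.surjective y
    simp [Equiv.permCongr_apply, hEI]
  refine ⟨fun c => E.subtypeEquiv (hE' c), ?_⟩
  simp only [elementR, map_sum, map_smul, relabel_pureTensor]
  rw [← (E.subtypeEquiv (hE' letterU)).permCongr.sum_comp]
  refine Finset.sum_congr rfl fun σu _ => ?_
  rw [← (E.subtypeEquiv (hE' letterUStar)).permCongr.sum_comp]
  refine Finset.sum_congr rfl fun θu _ => ?_
  rw [← (E.subtypeEquiv (hE' letterV)).permCongr.sum_comp]
  refine Finset.sum_congr rfl fun σv _ => ?_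
  rw [← (E.subtypeEquiv (hE' letterVStar)).permCongr.sum_comp]
  refine Finset.sum_congr rfl fun θv _ => ?_
  rw [concat_permCongr, hI, ← Equiv.permCongr_mul, numCycles_permCongr]

end Relabel

/-! ### Traces of words as sums over index functions -/

section Trace

variable {N : ℕ}

/-- Path expansion with `n + 1` vertices. Pinning the endpoints by a condition keeps the paths plain
functions, so the induction simply prepends a vertex. -/
theorem prod_ofFn_apply {n : ℕ} (M : Fin n → Matrix (Fin N) (Fin N) ℂ) (i j : Fin N) :
    (List.ofFn M).prod i j = ∑ k : Fin (n + 1) → Fin N,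
      if k 0 = i ∧ k (Fin.last n) = j then ∏ x, M x (k x.castSucc) (k x.succ) else 0 := by
  induction n generalizing i with
  | zero =>
    rw [← (Equiv.funUnique (Fin 1) (Fin N)).symm.sum_comp]
    simp [Matrix.one_apply, ite_and]
  | succ n ih =>
    rw [List.ofFn_succ, List.prod_cons, Matrix.mul_apply,
      ← (Fin.consEquiv fun _ => Fin N).sum_comp, Fintype.sum_prod_type]
    simp only [ih, Finset.mul_sum, Fin.consEquiv_apply]
    rw [Finset.sum_comm, Finset.sum_comm (s := (Finset.univ : Finset (Fin N)))]
    refine Finset.sum_congr rfl fun k _ => ?_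
    simp only [Fin.cons_zero, ite_and, Finset.sum_ite_eq', Finset.sum_ite_eq, mul_ite, mul_zero,
      Finset.mem_univ, if_true]
    simp only [← Fin.succ_last, Fin.cons_succ, Fin.prod_univ_succ, Fin.castSucc_zero,
      Fin.cons_zero, ← Fin.succ_castSucc]

/-- The trace closes the path by identifying its two ends. For `n = 0` the left side is `N` and the
right side is `1`, which is why words must be non-empty. -/
theorem trace_prod_ofFn {n : ℕ} (hn : n ≠ 0) (M : Fin n → Matrix (Fin N) (Fin N) ℂ) :
    (List.ofFn M).prod.trace = ∑ k : Fin n → Fin N, ∏ x, M x (k x) (k (finRotate n x)) := by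
  obtain ⟨m, rfl⟩ := Nat.exists_eq_succ_of_ne_zero hn
  simp only [Matrix.trace, Matrix.diag_apply, prod_ofFn_apply]
  rw [Finset.sum_comm]
  simp only [ite_and, Finset.sum_ite_eq, Finset.mem_univ, if_true]
  rw [← (Fin.snocEquiv fun _ => Fin N).sum_comp, Fintype.sum_prod_type, Finset.sum_comm]
  refine Finset.sum_congr rfl fun k _ => ?_
  simp only [Fin.snocEquiv_apply, Fin.snoc_last]
  have h0 : ∀ z : Fin N, (Fin.snoc k z : Fin (m + 2) → Fin N) 0 = k 0 := fun z => by
    rw [← Fin.castSucc_zero, Fin.snoc_castSucc]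
  simp only [h0, Finset.sum_ite_eq', Finset.mem_univ, if_true]
  refine Finset.prod_congr rfl fun x _ => ?_
  rw [Fin.snoc_castSucc]
  congr 1
  induction x using Fin.lastCases with
  | last => rw [Fin.succ_last, Fin.snoc_last, finRotate_last]
  | cast x =>
    rw [Fin.succ_castSucc, Fin.snoc_castSucc]
    congr 1
    exact Fin.ext (by rw [coe_finRotate_of_ne_last (Fin.castSucc_lt_last x).ne]; simp)

/-- The unitary matrix that is substituted for a letter. -/
def evalLetter (U V : UGroup N) (c : Letter) : Matrix (Fin N) (Fin N) ℂ :=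
  if c.2 then (![U, V] c.1).1 else star (![U, V] c.1).1

theorem coe_evalWord (L : Word) (U V : UGroup N) :
    (evalWord L U V : Matrix (Fin N) (Fin N) ℂ) = (L.map (evalLetter U V)).prod := by
  rw [evalWord, FreeGroup.lift_mk]
  induction L with
  | nil => simp
  | cons c L ih =>
    rw [List.map_cons, List.prod_cons, List.map_cons, List.prod_cons, ← ih]
    obtain ⟨g, b⟩ := c
    cases b <;> rfl

theorem traceWord_eq_sum {L : Word} (hL : L ≠ []) (U V : UGroup N) :
    traceWord L U V = ∑ k : Fin L.length → Fin N,
      ∏ x, evalLetter U V (L.get x) (k x) (k (finRotate _ x)) := by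
  rw [traceWord, coe_evalWord]
  conv_lhs => rw [← List.ofFn_get L, List.map_ofFn]
  exact trace_prod_ofFn (by simpa using hL) _

theorem traceWord_invRev (L : Word) (U V : UGroup N) :
    traceWord (FreeGroup.invRev L) U V = star (traceWord L U V) := by
  rw [traceWord, traceWord, evalWord, evalWord, ← FreeGroup.inv_mk, map_inv,
    ← Matrix.trace_conjTranspose]
  rfl

end Trace

/-! ### Integration of the trace expansion -/

section Integral

variable {p : ℕ} (w : Fin p → Word) {N : ℕ}

theorem prod_norm_traceWord (U V : UGroup N) :
    ((∏ i, ‖traceWord (w i) U V‖ ^ 2 : ℝ) : ℂ) = ∏ q, traceWord (wordAt w q) U V := by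
  rw [Fintype.prod_prod_type]
  push_cast
  refine Finset.prod_congr rfl fun i _ => ?_
  rw [Fintype.prod_bool]
  simp only [wordAt, if_true, Bool.false_eq_true, if_false, traceWord_invRev]
  exact (Complex.mul_conj' _).symm

theorem prod_traceWord (hw : ∀ i, w i ≠ []) (U V : UGroup N) :
    ∏ q, traceWord (wordAt w q) U V = ∑ k : Occ w → Fin N,
      ∏ x, evalLetter U V (letterAt w x) (k x) (k (succOcc w x)) := by
  have hw' : ∀ q, wordAt w q ≠ [] := by
    rintro ⟨i, b⟩ h
    refine hw i (List.length_eq_zero_iff.1 ?_)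
    have := congrArg List.length h
    cases b <;> simpa [wordAt] using this
  simp_rw [traceWord_eq_sum (hw' _)]
  rw [Finset.prod_univ_sum, Fintype.piFinset_univ,
    ← (Equiv.piCurry fun (q : Fin p × Bool) (_ : Fin (wordAt w q).length) => Fin N).sum_comp]
  refine Finset.sum_congr rfl fun k _ => ?_
  rw [Fintype.prod_sigma]
  rfl

/-- The part of a product of matrix entries that belongs to one generator. -/
def generatorFactor (g : Fin 2) (k : Occ w → Fin N) (U : UGroup N) : ℂ :=
  (∏ x : OccOf w (g, true), U.1 (k x) (k (succOcc w x))) *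
    ∏ x : OccOf w (g, true),
      star (U.1 (k (succOcc w (psiOn w g x))) (k (psiOn w g x)))

/-- Grouping by letter separates `U` from `V`. The products over inverse letters are pulled back
along `Ψ`, so that entries and conjugate entries run over one index set, as in `moment`. -/
theorem prod_evalLetter (k : Occ w → Fin N) (U V : UGroup N) :
    ∏ x, evalLetter U V (letterAt w x) (k x) (k (succOcc w x)) =
      generatorFactor w 0 k U * generatorFactor w 1 k V := by
  have h1 : ∀ c : Letter, (∏ x : OccOf w c, evalLetter U V (letterAt w x) (k x) (k (succOcc w x)))
      = ∏ x : OccOf w c, evalLetter U V c (k x) (k (succOcc w x)) :=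
    fun c => Finset.prod_congr rfl fun x _ => by rw [x.2]
  rw [← Fintype.prod_fiberwise (letterAt w)]
  simp only [h1]
  rw [Fintype.prod_prod_type, Fin.prod_univ_two, Fintype.prod_bool, Fintype.prod_bool,
    ← (psiOn w 0).prod_comp, ← (psiOn w 1).prod_comp]
  rfl

/-- The condition on indices imposed by a pair of permutations for one generator. -/
def IndexCondition (g : Fin 2) (k : Occ w → Fin N) (σ : Equiv.Perm (OccOf w (g, true)))
    (θ : Equiv.Perm (OccOf w (g, false))) : Prop :=
  (∀ x : OccOf w (g, true), k x = k (succPsi w (σ x))) ∧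
    ∀ y : OccOf w (g, false), k y = k (succPsi w (θ y))

theorem continuous_generatorFactor (g : Fin 2) (k : Occ w → Fin N) :
    Continuous (generatorFactor w g k) :=
  continuous_moment_integrand _ _ _ _

theorem coe_psiOn_symm (g : Fin 2) (y : OccOf w (g, false)) :
    ((psiOn w g).symm y : Occ w) = psi w y := rfl

theorem coe_psiOn (g : Fin 2) (x : OccOf w (g, true)) : (psiOn w g x : Occ w) = psi w x := rfl

theorem psi_psi (x : Occ w) : psi w (psi w x) = x := psiFun_involutive w x

open scoped Classical in
theorem integral_generatorFactor (g : Fin 2) (hN : Nat.card (OccOf w (g, true)) ≤ N)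
    (k : Occ w → Fin N) :
    ∫ U, generatorFactor w g k U ∂(haarU N) =
      ∑ σ, ∑ θ, weingarten N (twist w g σ θ) * if IndexCondition w g k σ θ then 1 else 0 := by
  have h : ∫ U, generatorFactor w g k U ∂(haarU N) =
      moment (fun x : OccOf w (g, true) => k x) (fun x => k (succOcc w x))
        (fun x => k (succOcc w (psiOn w g x))) (fun x => k (psiOn w g x)) := rfl
  rw [h, moment_eq_sum_weingarten (by simpa using hN)]
  refine Finset.sum_congr rfl fun σ _ => ?_
  -- The substitution `τ = (Ψ⁻¹θΨ)⁻¹` turns `στ⁻¹` into the twist `σΨ⁻¹θΨ` and the column condition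
  -- into one on the inverse letters.
  rw [← ((psiOn w g).symm.permCongr.trans (Equiv.inv _)).sum_comp]
  refine Finset.sum_congr rfl fun θ _ => ?_
  have h1 : weingarten N (σ * (((psiOn w g).symm.permCongr.trans (Equiv.inv _)) θ)⁻¹) =
      weingarten N (twist w g σ θ) := rfl
  rw [h1, ite_zero_mul_ite_zero, one_mul]
  congr 2
  rw [eq_iff_iff, IndexCondition]
  refine and_congr funext_iff ?_
  have hs : Equiv.symm ((psiOn w g).symm.permCongr θ) = (psiOn w g).symm.permCongr θ.symm := rfl
  rw [funext_iff]
  simp only [Equiv.trans_apply, Equiv.inv_apply, Function.comp_apply]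
  constructor
  · intro h2 y
    have h3 := h2 ((psiOn w g).symm (θ y))
    simpa [hs, Equiv.permCongr_apply, succPsi, coe_psiOn_symm, eq_comm] using h3
  · intro h2 x
    have h3 := h2 (θ.symm (psiOn w g x))
    simpa [hs, Equiv.permCongr_apply, succPsi, coe_psiOn, psi_psi, eq_comm] using h3

theorem concat_apply_U (σu : Equiv.Perm (OccOf w letterU)) (θu : Equiv.Perm (OccOf w letterUStar))
    (σv : Equiv.Perm (OccOf w letterV)) (θv : Equiv.Perm (OccOf w letterVStar))
    (x : OccOf w letterU) : concat w σu θu σv θv x = σu x := by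
  have h : ∀ d, letterU ≠ d → ¬ letterAt w x = d := fun d h => by rwa [x.2]
  simp only [concat, Equiv.Perm.mul_apply]
  rw [Equiv.Perm.ofSubtype_apply_of_not_mem θv (h _ (by decide)),
    Equiv.Perm.ofSubtype_apply_of_not_mem σv (h _ (by decide)),
    Equiv.Perm.ofSubtype_apply_of_not_mem θu (h _ (by decide)),
    Equiv.Perm.ofSubtype_apply_coe]

theorem concat_apply_UStar (σu : Equiv.Perm (OccOf w letterU))
    (θu : Equiv.Perm (OccOf w letterUStar)) (σv : Equiv.Perm (OccOf w letterV))
    (θv : Equiv.Perm (OccOf w letterVStar)) (x : OccOf w letterUStar) :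
    concat w σu θu σv θv x = θu x := by
  have h : ∀ d, letterUStar ≠ d → ∀ y : OccOf w letterUStar, ¬ letterAt w y = d :=
    fun d h y => by rwa [y.2]
  simp only [concat, Equiv.Perm.mul_apply]
  rw [Equiv.Perm.ofSubtype_apply_of_not_mem θv (h _ (by decide) _),
    Equiv.Perm.ofSubtype_apply_of_not_mem σv (h _ (by decide) _),
    Equiv.Perm.ofSubtype_apply_coe,
    Equiv.Perm.ofSubtype_apply_of_not_mem σu (h _ (by decide) _)]

theorem concat_apply_V (σu : Equiv.Perm (OccOf w letterU)) (θu : Equiv.Perm (OccOf w letterUStar))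
    (σv : Equiv.Perm (OccOf w letterV)) (θv : Equiv.Perm (OccOf w letterVStar))
    (x : OccOf w letterV) : concat w σu θu σv θv x = σv x := by
  have h : ∀ d, letterV ≠ d → ∀ y : OccOf w letterV, ¬ letterAt w y = d :=
    fun d h y => by rwa [y.2]
  simp only [concat, Equiv.Perm.mul_apply]
  rw [Equiv.Perm.ofSubtype_apply_of_not_mem θv (h _ (by decide) _),
    Equiv.Perm.ofSubtype_apply_coe,
    Equiv.Perm.ofSubtype_apply_of_not_mem θu (h _ (by decide) _),
    Equiv.Perm.ofSubtype_apply_of_not_mem σu (h _ (by decide) _)]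

theorem concat_apply_VStar (σu : Equiv.Perm (OccOf w letterU))
    (θu : Equiv.Perm (OccOf w letterUStar)) (σv : Equiv.Perm (OccOf w letterV))
    (θv : Equiv.Perm (OccOf w letterVStar)) (x : OccOf w letterVStar) :
    concat w σu θu σv θv x = θv x := by
  have h : ∀ d, letterVStar ≠ d → ∀ y : OccOf w letterVStar, ¬ letterAt w y = d :=
    fun d h y => by rwa [y.2]
  simp only [concat, Equiv.Perm.mul_apply]
  rw [Equiv.Perm.ofSubtype_apply_coe,
    Equiv.Perm.ofSubtype_apply_of_not_mem σv (h _ (by decide) _),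
    Equiv.Perm.ofSubtype_apply_of_not_mem θu (h _ (by decide) _),
    Equiv.Perm.ofSubtype_apply_of_not_mem σu (h _ (by decide) _)]

theorem indexCondition_iff (k : Occ w → Fin N)
    (σu : Equiv.Perm (OccOf w letterU)) (θu : Equiv.Perm (OccOf w letterUStar))
    (σv : Equiv.Perm (OccOf w letterV)) (θv : Equiv.Perm (OccOf w letterVStar)) :
    IndexCondition w 0 k σu θu ∧ IndexCondition w 1 k σv θv ↔
      k = k ∘ (succPsi w * concat w σu θu σv θv) := by
  rw [funext_iff]
  simp only [IndexCondition, Function.comp_apply, Equiv.Perm.mul_apply]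
  constructor
  · rintro ⟨⟨h1, h2⟩, h3, h4⟩ x
    obtain ⟨c, hc⟩ : ∃ c, letterAt w x = c := ⟨_, rfl⟩
    obtain ⟨g, b⟩ := c
    fin_cases g <;> cases b
    · exact (h2 (Subtype.mk x hc)).trans (congrArg (fun y => k (succPsi w y))
        (concat_apply_UStar w σu θu σv θv (Subtype.mk x hc)).symm)
    · exact (h1 (Subtype.mk x hc)).trans (congrArg (fun y => k (succPsi w y))
        (concat_apply_U w σu θu σv θv (Subtype.mk x hc)).symm)
    · exact (h4 (Subtype.mk x hc)).trans (congrArg (fun y => k (succPsi w y))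
        (concat_apply_VStar w σu θu σv θv (Subtype.mk x hc)).symm)
    · exact (h3 (Subtype.mk x hc)).trans (congrArg (fun y => k (succPsi w y))
        (concat_apply_V w σu θu σv θv (Subtype.mk x hc)).symm)
  · intro h
    exact ⟨⟨fun x => (h x).trans (by rw [concat_apply_U]),
      fun x => (h x).trans (by rw [concat_apply_UStar])⟩,
      fun x => (h x).trans (by rw [concat_apply_V]),
      fun x => (h x).trans (by rw [concat_apply_VStar])⟩

theorem functionalPhi_elementR (N : ℕ) :
    functionalPhi w N (elementR w N) =
      ∑ σu : Equiv.Perm (OccOf w letterU), ∑ θu : Equiv.Perm (OccOf w letterUStar),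
        ∑ σv : Equiv.Perm (OccOf w letterV), ∑ θv : Equiv.Perm (OccOf w letterVStar),
          (N : ℂ) ^ numCycles (succPsi w * concat w σu θu σv θv) *
            (weingarten N (twist w 0 σu θu) * weingarten N (twist w 1 σv θv)) := by
  simp only [elementR, map_sum, map_smul, functionalPhi_pureTensor, smul_eq_mul]

theorem integral_prod_norm_traceWord (hw : ∀ i, w i ≠ [])
    (hn : Nat.card (OccOf w letterU) ≤ N) (hm : Nat.card (OccOf w letterV) ≤ N) :
    ((∫ g : UGroup N × UGroup N, ∏ i : Fin p, ‖traceWord (w i) g.1 g.2‖ ^ 2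
      ∂((haarU N).prod (haarU N)) : ℝ) : ℂ) = functionalPhi w N (elementR w N) := by
  classical
  rw [← integral_complex_ofReal]
  simp_rw [prod_norm_traceWord, prod_traceWord w hw, prod_evalLetter]
  -- For fixed `k` the integrand is a function of `U` times a function of `V`, so the double
  -- integral factors.
  rw [MeasureTheory.integral_finsetSum _ fun k _ =>
    (integrable_of_continuous (continuous_generatorFactor w 0 k)).mul_prod
      (integrable_of_continuous (continuous_generatorFactor w 1 k))]
  simp_rw [MeasureTheory.integral_prod_mul, integral_generatorFactor w 0 hn,
    integral_generatorFactor w 1 hm]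
  rw [functionalPhi_elementR]
  simp_rw [Finset.sum_mul]
  simp_rw [Finset.mul_sum]
  rw [Finset.sum_comm]
  refine Finset.sum_congr rfl fun σu _ => ?_
  rw [Finset.sum_comm]
  refine Finset.sum_congr rfl fun θu _ => ?_
  rw [Finset.sum_comm]
  refine Finset.sum_congr rfl fun σv _ => ?_
  rw [Finset.sum_comm]
  refine Finset.sum_congr rfl fun θv _ => ?_
  -- With the four permutations fixed, the cycle-count power is itself the number of admissible `k`,
  -- so the two sides agree term by term.
  rw [← sum_invariant, Finset.sum_mul]
  refine Finset.sum_congr rfl fun k _ => ?_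
  rw [mul_mul_mul_comm, ite_zero_mul_ite_zero, one_mul, mul_comm]
  simp only [indexCondition_iff]

end Integral
end WordTrace

theorem mainTheorem4 (p : ℕ) (w : Fin p → WordTrace.Word) (hw : ∀ i, w i ≠ []) (N : ℕ)
    (hn : Nat.card (WordTrace.OccOf w WordTrace.letterU) ≤ N)
    (hm : Nat.card (WordTrace.OccOf w WordTrace.letterV) ≤ N) :
    (IsUnit (WordTrace.cycleElement N (WordTrace.OccOf w WordTrace.letterU)) ∧
      IsUnit (WordTrace.cycleElement N (WordTrace.OccOf w WordTrace.letterV))) ∧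
    (((∫ g : WordTrace.UGroup N × WordTrace.UGroup N,
        ∏ i : Fin p, ‖WordTrace.traceWord (w i) g.1 g.2‖ ^ 2
          ∂((WordTrace.haarU N).prod (WordTrace.haarU N)) : ℝ) : ℂ) =
      WordTrace.functionalPhi w N (WordTrace.elementR w N)) ∧
    (∀ (p' : ℕ) (w' : Fin p' → WordTrace.Word),
      (∀ c d : WordTrace.Letter, WordTrace.crossCard w c d = WordTrace.crossCard w' c d) →
      ∃ e : ∀ c : WordTrace.Letter, WordTrace.OccOf w c ≃ WordTrace.OccOf w' c,
        WordTrace.relabel e (WordTrace.elementR w N) = WordTrace.elementR w' N) :=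
  ⟨⟨WordTrace.isUnit_cycleElement (by simpa using hn),
    WordTrace.isUnit_cycleElement (by simpa using hm)⟩,
    WordTrace.integral_prod_norm_traceWord w hw hn hm,
    fun _ w' h => WordTrace.exists_relabel_elementR w w' N h⟩
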